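/- Let $P$ be a polynomial with complex coefficients, $\deg(P)\ge 2$ and $P(0)\neq 0$, and let $f:\mathbb{C}\to\mathbb{C}$ be the entire function $f(z)=P(e^z)/e^z$. Write $f^{\circ n}$ for the $n$-th iterate of $f$. Let $$I(f)=\{z\in\mathbb{C}: f^{\circ n}(z)\to\infty \text{ as } n\to\infty\}$$ be the escaping set of $f$. Let the Fatou set $F(f)$ be the maximal open subset of $\mathbb{C}$ on which the family of iterates $\{f^{\circ n}:n\in\mathbb{N}\}$ is normal in the sense of Montel (every sequence in the family has a subsequence which converges locally uniformly with respect to the spherical metric, the limit being allowed to take the value $\infty$), and let $J(f)=\mathbb{C}\setminus F(f)$ be the Julia set of $f$. Then $$I(f)\subseteq J(f).$$ -/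

import Mathlib

open Filter Topology

/-- A family `F` of functions is normal on `U` in the sense of Montel: every sequence in `F` has a
subsequence which converges locally uniformly on `U` as a sequence of maps into the Riemann sphere
`OnePoint ℂ`; so the limit function may take the value `∞`. The sphere is a compact Hausdorff space
and carries exactly one uniform structure compatible with its topology (that of the spherical or
chordal metric); this is the one used here. -/
def IsNormalFamilyOn (F : Set (ℂ → ℂ)) (U : Set ℂ) : Prop :=
  letI : UniformSpace (OnePoint ℂ) := uniformSpaceOfCompactR1
  ∀ g : ℕ → ℂ → ℂ, (∀ n, g n ∈ F) →
    ∃ φ : ℕ → ℕ, StrictMono φ ∧ ∃ h : ℂ → OnePoint ℂ,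
      TendstoLocallyUniformlyOn (fun k z => (g (φ k) z : OnePoint ℂ)) h atTop U

/-- The Fatou set of `f`: the largest open set on which the family of iterates of `f` is normal,
that is, the union of all open sets on which it is normal. -/
def fatouSet (f : ℂ → ℂ) : Set ℂ :=
  ⋃₀ {U : Set ℂ | IsOpen U ∧ IsNormalFamilyOn (Set.range fun n : ℕ => f^[n]) U}

/-- The Julia set of `f`: the complement of the Fatou set. -/
def juliaSet (f : ℂ → ℂ) : Set ℂ := (fatouSet f)ᶜ

/-- The escaping set of `f`: the points whose iterates tend to infinity. -/
def escapingSet (f : ℂ → ℂ) : Set ℂ :=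
  {z : ℂ | Tendsto (fun n : ℕ => ‖f^[n] z‖) atTop atTop}

/-!
The function `f z = P (exp z) / exp z` is bounded on every vertical strip `|re z| ≤ K`, while for
`K` large it satisfies `‖f‖ ≥ 4` and `‖f'‖ ≥ ‖f‖ / 2` off the strip
(`exists_strip_logDeriv_bound`): as a function of `w = exp z`, the logarithmic derivative `f' / f`
is `w * P' w / P w - 1`, which tends to `deg P - 1 ≥ 1` as `w → ∞` and to `-1` as `w → 0`. These
two properties are all that is needed (`escapingSet_subset_juliaSet_of_strip`).

Suppose that an escaping point `z₀` lies in the Fatou set. By normality, all late iterates are large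
on a common disc around `z₀` (`eventually_lt_norm_iterate_of_mem_fatouSet`); because `f` is bounded
on the strip, they even map this disc into `{|re z| > K}`, hence by connectedness each maps it into
a half-plane not containing `0`. Near a point `z` at distance at least `ρ` from the boundary of the
disc, the Schwarz lemma for half-planes (`norm_deriv_le_of_re_pos`) bounds the logarithmic
derivative of every such iterate by `2 / ρ`. The logarithmic derivative of `f^[n+1]` at `z` is
`f' / f` at `f^[n] z` times the derivative of `f^[n]` at `z`, so the derivatives of the iterates
at `z` are bounded by `4 / ρ`. On the other hand each late step multiplies them by at least `2` in
norm, so they are unbounded as soon as none of them vanishes, which holds at all points `z ≠ z₀`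
near `z₀` by the identity theorem.
-/

open Metric Bornology

/-! ### Schwarz lemma for half-planes -/

/-- A holomorphic map from a disc of radius `r` to the right half-plane has logarithmic derivative
at most `2 / r` at the centre: compose with the Cayley transform that sends the value at the
centre to `0` and apply the Schwarz lemma. -/
theorem norm_deriv_le_of_re_pos {G : ℂ → ℂ} {c : ℂ} {r : ℝ} (hr : 0 < r)
    (hG : DifferentiableOn ℂ G (ball c r)) (hpos : ∀ z ∈ ball c r, 0 < (G z).re) :
    ‖deriv G c‖ ≤ 2 * ‖G c‖ / r := by
  set a := G c with ha
  have hc : c ∈ ball c r := mem_ball_self hr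
  have hapos : 0 < a.re := hpos c hc
  have hden : ∀ z ∈ ball c r, G z + (starRingEnd ℂ) a ≠ 0 := by
    intro z hz h
    have h1 := congrArg Complex.re h
    have h2 := hpos z hz
    simp at h1
    linarith
  have hmaps : Set.MapsTo (fun z => (G z - a) / (G z + (starRingEnd ℂ) a)) (ball c r)
      (closedBall ((fun z => (G z - a) / (G z + (starRingEnd ℂ) a)) c) 1) := by
    intro z hz
    have h2 := hpos z hz
    have hle : ‖G z - a‖ ≤ ‖G z + (starRingEnd ℂ) a‖ := by
      rw [Complex.norm_def, Complex.norm_def]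
      apply Real.sqrt_le_sqrt
      simp only [Complex.normSq_apply, Complex.sub_re, Complex.sub_im, Complex.add_re,
        Complex.add_im, Complex.conj_re, Complex.conj_im]
      nlinarith [mul_pos h2 hapos]
    simp only [← ha, sub_self, zero_div, mem_closedBall, dist_zero_right, norm_div]
    exact div_le_one_of_le₀ hle (norm_nonneg _)
  have hdiff : DifferentiableOn ℂ (fun z => (G z - a) / (G z + (starRingEnd ℂ) a)) (ball c r) :=
    (hG.sub_const a).div (hG.add_const _) hden
  have hS := Complex.norm_deriv_le_div_of_mapsTo_ball hdiff hmaps hr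
  have hGc : HasDerivAt G (deriv G c) c :=
    (hG.differentiableAt (isOpen_ball.mem_nhds hc)).hasDerivAt
  have hd := ((hGc.sub_const a).div (hGc.add_const ((starRingEnd ℂ) a)) (hden c hc)).deriv
  have hval : (G c + (starRingEnd ℂ) a) = ((2 * a.re : ℝ) : ℂ) := by
    rw [← ha, Complex.add_conj]
  have hd' : deriv (fun z => (G z - a) / (G z + (starRingEnd ℂ) a)) c
      = deriv G c / ((2 * a.re : ℝ) : ℂ) := by
    have hne : ((2 * a.re : ℝ) : ℂ) ≠ 0 := by exact_mod_cast (by positivity : (2 * a.re) ≠ 0)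
    refine hd.trans ?_
    rw [hval, ← ha, sub_self, zero_mul, sub_zero]
    field_simp
  rw [hd', norm_div, Complex.norm_real, Real.norm_of_nonneg (by positivity),
    div_le_div_iff₀ (by positivity) hr] at hS
  rw [le_div_iff₀ hr]
  nlinarith [Complex.re_le_norm a]

/-- A holomorphic function on a disc whose real part never vanishes takes values in one of the two
half-planes bounded by the imaginary axis, so that its logarithmic derivative at the centre is
controlled by the radius. -/
theorem norm_deriv_le_of_re_ne_zero {G : ℂ → ℂ} {c : ℂ} {r : ℝ} (hr : 0 < r)
    (hG : DifferentiableOn ℂ G (ball c r)) (hne : ∀ z ∈ ball c r, (G z).re ≠ 0) :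
    ‖deriv G c‖ ≤ 2 * ‖G c‖ / r := by
  have hc : c ∈ ball c r := mem_ball_self hr
  have hcont : ContinuousOn (fun z => (G z).re) (ball c r) :=
    Complex.continuous_re.comp_continuousOn hG.continuousOn
  have hpre : IsPreconnected (ball c r) := (convex_ball c r).isPreconnected
  have key : ∀ x ∈ ball c r, ∀ y ∈ ball c r, (G x).re < 0 → 0 < (G y).re → False := by
    intro x hx y hy hx0 hy0
    obtain ⟨z, hz, hz0⟩ := hpre.intermediate_value hx hy hcont ⟨hx0.le, hy0.le⟩
    exact hne z hz hz0
  rcases (hne c hc).lt_or_gt with h | h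
  · have := norm_deriv_le_of_re_pos (G := fun z => -G z) hr hG.neg (fun z hz => by
      rcases (hne z hz).lt_or_gt with h' | h'
      · simpa using h'
      · exact (key c hc z hz h h').elim)
    simpa [deriv.fun_neg] using this
  · exact norm_deriv_le_of_re_pos hr hG (fun z hz => by
      rcases (hne z hz).lt_or_gt with h' | h'
      · exact (key z hz c hc h' h).elim
      · exact h')

/-! ### Normality at an escaping point -/

/-- If an escaping point lies in the Fatou set, then all late iterates are large on a common
neighbourhood of it: a locally uniform limit of iterates is a continuous map to the sphere with
value `∞` at that point. -/
theorem eventually_lt_norm_iterate_of_mem_fatouSet {f : ℂ → ℂ} (hf : Continuous f) {z₀ : ℂ}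
    (hesc : z₀ ∈ escapingSet f) (hfat : z₀ ∈ fatouSet f) (R : ℝ) :
    ∃ r > 0, ∃ N : ℕ, ∀ n ≥ N, ∀ z ∈ ball z₀ r, R < ‖f^[n] z‖ := by
  obtain ⟨U, ⟨hU, hnorm⟩, hz₀⟩ := hfat
  by_contra! hcon
  choose m hm x hx hxR using fun n : ℕ =>
    hcon (1 / ((n : ℝ) + 1)) Nat.one_div_pos_of_nat n
  let : UniformSpace (OnePoint ℂ) := uniformSpaceOfCompactR1
  obtain ⟨φ, hφ, h, hlim⟩ := hnorm (fun n => f^[m n]) (fun n => ⟨m n, rfl⟩)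
  have hm_top : Tendsto (fun k => m (φ k)) atTop atTop :=
    tendsto_atTop_mono (fun k => hm (φ k)) hφ.tendsto_atTop
  have hcoe : ∀ u : ℕ → ℂ, Tendsto (fun k => (u k : OnePoint ℂ)) atTop (𝓝 OnePoint.infty) ↔
      Tendsto (fun k => ‖u k‖) atTop atTop := by
    intro u
    rw [tendsto_norm_atTop_iff_cobounded, Metric.cobounded_eq_cocompact,
      ← coclosedCompact_eq_cocompact, ← OnePoint.comap_coe_nhds_infty, tendsto_comap_iff]
    rfl
  have hcont : ContinuousOn h U := hlim.continuousOn <| Eventually.frequently <|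
    Eventually.of_forall fun k =>
      (OnePoint.continuous_coe.comp (hf.iterate (m (φ k)))).continuousOn
  have hinf : h z₀ = OnePoint.infty :=
    tendsto_nhds_unique (hlim.tendsto_at hz₀) ((hcoe _).2 (hesc.comp hm_top))
  have hxlim : Tendsto (fun k => x (φ k)) atTop (𝓝[U] z₀) := by
    rw [hU.nhdsWithin_eq hz₀]
    refine Tendsto.comp (g := x) ?_ hφ.tendsto_atTop
    rw [tendsto_iff_dist_tendsto_zero]
    exact squeeze_zero (fun _ => dist_nonneg) (fun n => (mem_ball.1 (hx n)).le)
      tendsto_one_div_add_atTop_nhds_zero_nat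
  have h1 := hlim.tendsto_comp (hcont z₀ hz₀) hz₀ hxlim
  rw [hinf] at h1
  obtain ⟨k, hk⟩ := (((hcoe _).1 h1).eventually_gt_atTop R).exists
  exact (hxR (φ k)).not_gt hk

/-! ### Functions that expand off a vertical strip -/

/-- A nonconstant entire function maps punctured neighbourhoods into punctured neighbourhoods, so
by the chain rule the zeros of the derivative of an iterate are isolated. -/
theorem eventually_deriv_iterate_ne_zero {f : ℂ → ℂ} (hf : Differentiable ℂ f)
    {b : ℂ} (hb : deriv f b ≠ 0) (z₀ : ℂ) (n : ℕ) :
    ∀ᶠ z in 𝓝[≠] z₀, deriv f^[n] z ≠ 0 := by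
  have han : ∀ z, AnalyticAt ℂ f z := fun z => hf.analyticAt z
  have hd : ∀ z, ∀ᶠ w in 𝓝[≠] z, deriv f w ≠ 0 := by
    intro z
    refine (han z).deriv.eventually_eq_zero_or_eventually_ne_zero.resolve_left fun h => hb ?_
    have hA : AnalyticOnNhd ℂ (deriv f) Set.univ := fun w _ => (han w).deriv
    exact hA.eqOn_zero_of_preconnected_of_eventuallyEq_zero isPreconnected_univ
      (Set.mem_univ z) h (Set.mem_univ b)
  have hpunct : ∀ z, Tendsto f (𝓝[≠] z) (𝓝[≠] (f z)) := by
    intro z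
    refine tendsto_nhdsWithin_of_tendsto_nhds_of_eventually_within _
      (hf.continuous.continuousAt.mono_left nhdsWithin_le_nhds) ?_
    refine ((han z).eventually_eq_or_eventually_ne analyticAt_const).resolve_left fun h => hb ?_
    have hA : AnalyticOnNhd ℂ f Set.univ := fun w _ => han w
    have heq := hA.eqOn_of_preconnected_of_eventuallyEq
      (analyticOnNhd_const (v := f z)) isPreconnected_univ (Set.mem_univ z) h
    have : f = fun _ => f z := funext fun w => heq (Set.mem_univ w)
    rw [this]
    simp
  have hpunct_iter : ∀ n, Tendsto f^[n] (𝓝[≠] z₀) (𝓝[≠] (f^[n] z₀)) := by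
    intro n
    induction n with
    | zero => exact tendsto_id
    | succ n ih => rw [Function.iterate_succ']; exact (hpunct _).comp ih
  induction n with
  | zero => simp
  | succ n ih =>
    filter_upwards [ih, (hpunct_iter n).eventually (hd _)] with z h1 h2
    rw [Function.iterate_succ', deriv_comp z (hf _) ((hf.iterate n) z)]
    exact mul_ne_zero h2 h1

/-- An entire function that is bounded on a vertical strip and, off the strip, is bounded below and
has logarithmic derivative bounded below, has no escaping points in its Fatou set. -/
theorem escapingSet_subset_juliaSet_of_strip {f : ℂ → ℂ} (hf : Differentiable ℂ f) {K R : ℝ}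
    (hK : 0 ≤ K) (hstrip : ∀ z : ℂ, |z.re| ≤ K → ‖f z‖ ≤ R)
    (hexp : ∀ z : ℂ, K < |z.re| → 4 ≤ ‖f z‖ ∧ ‖f z‖ ≤ 2 * ‖deriv f z‖) :
    escapingSet f ⊆ juliaSet f := by
  intro z₀ hesc hfat
  obtain ⟨r, hr, N, hN⟩ :=
    eventually_lt_norm_iterate_of_mem_fatouSet hf.continuous hesc hfat R
  have hre : ∀ n ≥ N, ∀ z ∈ ball z₀ r, K < |(f^[n] z).re| := by
    intro n hn z hz
    by_contra! h
    have h1 := hstrip _ h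
    rw [← Function.iterate_succ_apply' f n z] at h1
    exact (hN (n + 1) (by omega) z hz).not_ge h1
  have hb : deriv f ((K + 1 : ℝ) : ℂ) ≠ 0 := by
    intro h0
    have := hexp ((K + 1 : ℝ) : ℂ) (by
      rw [Complex.ofReal_re, abs_of_nonneg (by linarith)]; linarith)
    rw [h0, norm_zero] at this
    linarith [this.1, this.2]
  obtain ⟨z₁, hz₁, hz₁r⟩ := ((eventually_deriv_iterate_ne_zero hf hb z₀ N).and
    (nhdsWithin_le_nhds (ball_mem_nhds z₀ hr))).exists
  obtain ⟨ρ, hρ, hsub⟩ := isOpen_iff.1 isOpen_ball z₁ hz₁r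
  have hchain : ∀ n, deriv f^[n + 1] z₁ = deriv f (f^[n] z₁) * deriv f^[n] z₁ := by
    intro n
    rw [Function.iterate_succ', deriv_comp z₁ (hf _) ((hf.iterate n) z₁)]
  have hbound : ∀ n ≥ N, ‖deriv f^[n] z₁‖ ≤ 4 / ρ := by
    intro n hn
    obtain ⟨h4, h2⟩ := hexp _ (hre n hn z₁ hz₁r)
    have hS := norm_deriv_le_of_re_ne_zero hρ (hf.iterate (n + 1)).differentiableOn
      (fun z hz h0 => by
        have := hre (n + 1) (by omega) z (hsub hz)
        rw [h0, abs_zero] at this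
        linarith)
    rw [hchain, norm_mul, Function.iterate_succ_apply', le_div_iff₀ hρ] at hS
    rw [le_div_iff₀ hρ]
    have h5 : ‖f (f^[n] z₁)‖ * (‖deriv f^[n] z₁‖ * ρ) ≤ ‖f (f^[n] z₁)‖ * 4 := by
      have := mul_le_mul_of_nonneg_right h2
        (mul_nonneg (norm_nonneg (deriv f^[n] z₁)) hρ.le)
      linarith
    exact le_of_mul_le_mul_left h5 (by linarith)
  have hgrow : ∀ k, 2 ^ k * ‖deriv f^[N] z₁‖ ≤ ‖deriv f^[N + k] z₁‖ := by
    intro k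
    induction k with
    | zero => simp
    | succ k ih =>
      obtain ⟨h4, h2⟩ := hexp _ (hre (N + k) (by omega) z₁ hz₁r)
      rw [← add_assoc, hchain, norm_mul, pow_succ]
      have := mul_le_mul_of_nonneg_right (by linarith : 2 ≤ ‖deriv f (f^[N + k] z₁)‖)
        (norm_nonneg (deriv f^[N + k] z₁))
      linarith
  have hpos : 0 < ‖deriv f^[N] z₁‖ := norm_pos_iff.2 hz₁
  obtain ⟨k, hk⟩ := pow_unbounded_of_one_lt (4 / ρ / ‖deriv f^[N] z₁‖) one_lt_two
  rw [div_lt_iff₀ hpos] at hk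
  linarith [hgrow k, hbound (N + k) (by omega)]

/-! ### Polynomials in the exponential -/

/-- Near `0` and near `∞`, the rational function `P w / w` is large, and its logarithmic derivative
with respect to `log w` is at least `1 / 2` in absolute value. -/
theorem eventually_polynomial_bounds {P : Polynomial ℂ} (hdeg : 2 ≤ P.natDegree)
    (h0 : P.eval 0 ≠ 0) :
    ∀ᶠ w in cobounded ℂ ⊔ 𝓝 0, 4 * ‖w‖ ≤ ‖P.eval w‖ ∧
      ‖P.eval w‖ ≤ 2 * ‖w * P.derivative.eval w - P.eval w‖ := by
  have hP : P ≠ 0 := by rintro rfl; simp at h0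
  rw [eventually_sup]
  constructor
  · have h1 : (Polynomial.X : Polynomial ℂ).degree < P.degree := by
      rw [Polynomial.degree_X, Polynomial.degree_eq_natDegree hP]
      exact_mod_cast hdeg
    have h2 : (Polynomial.X * P.derivative - Polynomial.C (P.natDegree : ℂ) * P).degree
        < P.degree := by
      rw [Polynomial.degree_eq_natDegree hP, Polynomial.degree_lt_iff_coeff_zero]
      intro n hn
      rcases n with _ | n
      · omega
      rw [Polynomial.coeff_sub, Polynomial.coeff_X_mul, Polynomial.coeff_derivative,
        Polynomial.coeff_C_mul]
      rcases hn.eq_or_lt with h | h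
      · rw [h]; push_cast; ring
      · rw [Polynomial.coeff_eq_zero_of_natDegree_lt h]; ring
    filter_upwards [(Polynomial.isLittleO_cobounded_of_degree_lt h1).def
        (by norm_num : (0 : ℝ) < 1 / 4),
      (Polynomial.isLittleO_cobounded_of_degree_lt h2).def (by norm_num : (0 : ℝ) < 1 / 2)]
      with w hw1 hw2
    simp only [Polynomial.eval_X, Polynomial.eval_sub, Polynomial.eval_mul,
      Polynomial.eval_C] at hw1 hw2
    refine ⟨by linarith, ?_⟩
    have hsplit : ((P.natDegree : ℂ) - 1) * P.eval w = (w * P.derivative.eval w - P.eval w)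
        - (w * P.derivative.eval w - (P.natDegree : ℂ) * P.eval w) := by ring
    have hn := norm_sub_le (w * P.derivative.eval w - P.eval w)
      (w * P.derivative.eval w - (P.natDegree : ℂ) * P.eval w)
    rw [← hsplit, norm_mul] at hn
    have hd : (1 : ℝ) ≤ ‖(P.natDegree : ℂ) - 1‖ := by
      have h3 : (2 : ℝ) ≤ P.natDegree := by exact_mod_cast hdeg
      have h4 : (P.natDegree : ℂ) - 1 = ((P.natDegree - 1 : ℝ) : ℂ) := by push_cast; ring
      rw [h4, Complex.norm_real, Real.norm_of_nonneg (by linarith)]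
      linarith
    nlinarith [norm_nonneg (P.eval w)]
  · have hpos : 0 < ‖P.eval 0‖ := norm_pos_iff.2 h0
    have c1 : ContinuousAt (fun w : ℂ => 4 * ‖w‖) 0 := by fun_prop
    have c2 : ContinuousAt (fun w : ℂ => ‖P.eval w‖) 0 := by fun_prop
    have c3 : ContinuousAt
        (fun w : ℂ => 2 * ‖w * P.derivative.eval w - P.eval w‖) 0 := by fun_prop
    filter_upwards [c1.eventually_lt c2 (by simpa using h0),
      c2.eventually_lt c3 (by simp only [zero_mul, zero_sub, norm_neg]; linarith)] with w h1 h2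
    exact ⟨h1.le, h2.le⟩

theorem hasDerivAt_polynomial_exp_div_exp (P : Polynomial ℂ) (z : ℂ) :
    HasDerivAt (fun z => P.eval (Complex.exp z) / Complex.exp z)
      ((Complex.exp z * P.derivative.eval (Complex.exp z) - P.eval (Complex.exp z))
        / Complex.exp z) z := by
  have he := Complex.hasDerivAt_exp z
  have hne := Complex.exp_ne_zero z
  refine (((P.hasDerivAt (Complex.exp z)).comp z he).div he hne).congr_deriv ?_
  rw [Function.comp_apply]
  field_simp

theorem exists_strip_logDeriv_bound {P : Polynomial ℂ} (hdeg : 2 ≤ P.natDegree)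
    (h0 : P.eval 0 ≠ 0) :
    ∃ K : ℝ, 0 ≤ K ∧ ∀ z : ℂ, K < |z.re| →
      4 ≤ ‖P.eval (Complex.exp z) / Complex.exp z‖ ∧
      ‖P.eval (Complex.exp z) / Complex.exp z‖ ≤
        2 * ‖deriv (fun z => P.eval (Complex.exp z) / Complex.exp z) z‖ := by
  have hev := eventually_polynomial_bounds hdeg h0
  rw [eventually_sup] at hev
  obtain ⟨K₁, hK₁⟩ := eventually_atTop.1
    (eventually_comap.1 (Complex.tendsto_exp_comap_re_atTop.eventually hev.1))
  obtain ⟨K₂, hK₂⟩ := eventually_atBot.1 (eventually_comap.1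
    (Complex.tendsto_exp_comap_re_atBot.eventually hev.2))
  refine ⟨max 0 (max K₁ (-K₂)), le_max_left _ _, fun z hz => ?_⟩
  obtain ⟨-, hz1, hz2⟩ : 0 < |z.re| ∧ K₁ < |z.re| ∧ -K₂ < |z.re| := by
    simpa only [max_lt_iff] using hz
  have hne : 0 < ‖Complex.exp z‖ := norm_pos_iff.2 (Complex.exp_ne_zero z)
  have hb : 4 * ‖Complex.exp z‖ ≤ ‖P.eval (Complex.exp z)‖ ∧ ‖P.eval (Complex.exp z)‖ ≤
      2 * ‖Complex.exp z * P.derivative.eval (Complex.exp z) - P.eval (Complex.exp z)‖ := by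
    rcases abs_cases z.re with ⟨h, -⟩ | ⟨h, -⟩
    · exact hK₁ z.re (by linarith) z rfl
    · exact hK₂ z.re (by linarith) z rfl
  rw [(hasDerivAt_polynomial_exp_div_exp P z).deriv, norm_div, norm_div, le_div_iff₀ hne,
    ← mul_div_assoc]
  exact ⟨hb.1, div_le_div_of_nonneg_right hb.2 hne.le⟩

theorem exists_norm_polynomial_exp_div_exp_le (P : Polynomial ℂ) (K : ℝ) :
    ∃ R : ℝ, ∀ z : ℂ, |z.re| ≤ K → ‖P.eval (Complex.exp z) / Complex.exp z‖ ≤ R := by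
  obtain ⟨M, hM⟩ := (isCompact_closedBall (0 : ℂ) (Real.exp K)).exists_bound_of_continuousOn
    P.continuous.continuousOn
  refine ⟨M / Real.exp (-K), fun z hz => ?_⟩
  have hle := abs_le.1 hz
  have h1 := hM (Complex.exp z) (by
    rw [mem_closedBall_zero_iff, Complex.norm_exp]
    exact Real.exp_le_exp.2 hle.2)
  rw [norm_div, Complex.norm_exp]
  exact div_le_div₀ ((norm_nonneg _).trans h1) h1 (Real.exp_pos _) (Real.exp_le_exp.2 hle.1)

theorem corollary2p9 (P : Polynomial ℂ) (hdeg : 2 ≤ P.natDegree) (h0 : P.eval 0 ≠ 0)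
    (f : ℂ → ℂ) (hf : ∀ z : ℂ, f z = P.eval (Complex.exp z) / Complex.exp z) :
    escapingSet f ⊆ juliaSet f := by
  obtain rfl : f = fun z => P.eval (Complex.exp z) / Complex.exp z := funext hf
  obtain ⟨K, hK, hexp⟩ := exists_strip_logDeriv_bound hdeg h0
  obtain ⟨R, hR⟩ := exists_norm_polynomial_exp_div_exp_le P K
  exact escapingSet_subset_juliaSet_of_strip
    (fun z => (hasDerivAt_polynomial_exp_div_exp P z).differentiableAt) hK hR hexp
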